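/- Let $Q_n$, $n\ge 0$, be the Yablonskii--Vorob'ev polynomials, defined by $Q_0=1$, $Q_1=z$ and $$Q_{n+1}Q_{n-1}=zQ_n^2-4\bigl(Q_nQ_n''-(Q_n')^2\bigr)\qquad(n\ge 1).$$ These are indeed polynomials: at every step the right-hand side is divisible by $Q_{n-1}$. For every $m\ge 0$, $Q_m$ has degree $\tfrac12 m(m+1)$ and its complex roots are simple; denote them by $z_{m,k}$, $1\le k\le \tfrac12 m(m+1)$. For every $n\ge 1$, $Q_{n-1}$ and $Q_n$ have no common root, and the following relations hold. For every $1\le j\le \tfrac12 n(n-1)$, with $\omega=z_{n-1,j}$ and $$A_p=\sum_{k=1,\,k\ne j}^{\frac12 n(n-1)}\frac1{(\omega-z_{n-1,k})^p}-\sum_{k=1}^{\frac12 n(n+1)}\frac1{(\omega-z_{n,k})^p},$$ one has $$A_1=0,\qquad A_2=\frac{\omega}{6},\qquad A_3=-\frac{n+1}{4},\qquad A_5=\omega\left(\frac{n+1}{24}-\frac1{36}\right).$$ For every $1\le j\le \tfrac12 n(n+1)$, with $\omega=z_{n,j}$ and $$B_p=\sum_{k=1}^{\frac12 n(n-1)}\frac1{(\omega-z_{n-1,k})^p}-\sum_{k=1,\,k\ne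 j}^{\frac12 n(n+1)}\frac1{(\omega-z_{n,k})^p},$$ one has $$B_1=0,\qquad B_2=-\frac{\omega}{6},\qquad B_3=-\frac{n-1}{4},\qquad B_5=\omega\left(\frac{n-1}{24}+\frac1{36}\right).$$ -/

import Mathlib

open Polynomial

/-- The Yablonskii–Vorob'ev polynomials over `ℂ`: `Q₀ = 1`, `Q₁ = z` and
`Qₙ₊₂ Qₙ = z Qₙ₊₁² - 4 (Qₙ₊₁ Qₙ₊₁'' - (Qₙ₊₁')²)`, solved for `Qₙ₊₂` by polynomial division
(that the division is exact is a property of the sequence, not part of this definition). -/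
noncomputable def yablonskiiVorobev : ℕ → ℂ[X]
  | 0 => 1
  | 1 => X
  | n + 2 =>
      (X * yablonskiiVorobev (n + 1) ^ 2
        - 4 * (yablonskiiVorobev (n + 1) * derivative (derivative (yablonskiiVorobev (n + 1)))
          - derivative (yablonskiiVorobev (n + 1)) ^ 2)) / yablonskiiVorobev n

/-- The finite set of complex roots of the `m`-th Yablonskii–Vorob'ev polynomial. -/
noncomputable def yvRoots (m : ℕ) : Finset ℂ :=
  (yablonskiiVorobev m).roots.toFinset

/-!
The Painlevé II equation `w'' = 2 w³ + z w + n` has the rational solution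
`w = Q_{n-1}' / Q_{n-1} - Q_n' / Q_n`. Written for the pair `(Q_{n-1}, Q_n)` it becomes two
bilinear differential equations of Hirota type. They imply that `Q_{n-1}` divides the right-hand
side of the recurrence, and they pass on to the pair `(Q_n, Q_{n+1})`, because the Wronskian of
`Q_{n+1}` and `Q_{n-1}` is `(2 n + 1) Q_n²`. The same Wronskian identity shows that a multiple root
of `Q_{n+1}` would be a root of `Q_n`, which the recurrence excludes.

At a root `ω` of `Q_{n-1}`, with `t = z - ω`, we have `w = 1 / t + F`, where the Taylor coefficients
of `F` are up to sign the differences of power sums in question; substituting this into Painlevé II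
determines those of order 0, 1, 2 and 4. The roots of `Q_n` are covered by the symmetry
`(w, n) ↦ (-w, -n)`, which exchanges the two polynomials.
-/

open scoped PowerSeries nonZeroDivisors

section Derivation

variable {R A : Type*} [CommRing R] [CommRing A] [Algebra R A] (D : Derivation R A A)

theorem derivation_ofNat (n : ℕ) [n.AtLeastTwo] : D (ofNat(n) : A) = 0 := by
  rw [← Nat.cast_ofNat (R := A), D.map_natCast]

theorem derivation_prod_eq_prod_mul_sum {ι : Type*} {s : Finset ι} {f g : ι → A}
    (h : ∀ i ∈ s, D (f i) = f i * g i) :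
    D (∏ i ∈ s, f i) = (∏ i ∈ s, f i) * ∑ i ∈ s, g i := by
  classical
  induction s using Finset.induction_on with
  | empty => simp
  | insert a s ha ih =>
    rw [Finset.prod_insert ha, Finset.sum_insert ha, D.leibniz, smul_eq_mul, smul_eq_mul,
      h a (Finset.mem_insert_self a s), ih fun i hi => h i (Finset.mem_insert_of_mem hi)]
    ring

/-- The right-hand side of the Yablonskii–Vorob'ev recurrence, in a ring with a derivation `D`, with
`x` in the role of the independent variable. -/
def todaRHS (x Q : A) : A :=
  x * Q ^ 2 - 4 * (Q * D (D Q) - D Q ^ 2)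

/-- The Hirota form of the second Painlevé equation `w'' = 2 w³ + x w + ν` for
`w = P' / P - Q' / Q`, where the prime denotes the derivation `D`. In terms of Hirota's bilinear
operators `𝒟ⁿ`, the two equations are `𝒟² P·Q = 0` and `(𝒟³ - x 𝒟 + ν) Q·P = 0`. -/
structure IsHirotaPair (x : A) (ν : R) (P Q : A) : Prop where
  bilin_two : D (D P) * Q - 2 * (D P * D Q) + P * D (D Q) = 0
  bilin_three : D (D (D Q)) * P - 3 * (D (D Q) * D P) + 3 * (D Q * D (D P)) - Q * D (D (D P))
    - x * (D Q * P - Q * D P) + algebraMap R A ν * (Q * P) = 0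

/-- The second Painlevé equation `w'' = 2 w³ + x w + ν` for `w = 1 / t + F`, where the prime denotes
the derivation `D` and `D t = 1`. The equation is multiplied by `t ^ 2`, which clears the pole. -/
def IsPainleveTwoRegularPart (t x : A) (ν : R) (F : A) : Prop :=
  t ^ 2 * D (D F) = 6 * F + 6 * t * F ^ 2 + 2 * t ^ 2 * F ^ 3
    + x * (t + t ^ 2 * F) + algebraMap R A ν * t ^ 2

variable {D} {x t P Q U : A} {ν : R}

theorem derivation_todaRHS (hx : D x = 1) :
    D (todaRHS D x Q) = Q ^ 2 + 2 * x * Q * D Q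
      - 4 * (Q * D (D (D Q)) - D Q * D (D Q)) := by
  simp only [todaRHS, pow_two, map_sub, D.leibniz, derivation_ofNat, hx, smul_eq_mul]
  ring

theorem isCoprime_of_mul_eq_todaRHS (h2 : IsUnit (2 : R)) (hQ : IsCoprime Q (D Q))
    (hU : U * P = todaRHS D x Q) : IsCoprime Q U := by
  have h2' : IsUnit (2 : A) := by simpa [map_ofNat] using h2.map (algebraMap R A)
  have toda_eq : todaRHS D x Q = (2 * D Q) ^ 2 + Q * (x * Q - 4 * D (D Q)) := by
    rw [todaRHS]; ring
  have coprime_sq : IsCoprime Q ((2 * D Q) ^ 2) :=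
    ((isCoprime_mul_unit_left_right h2' Q (D Q)).2 hQ).pow_right
  have coprime_toda : IsCoprime Q (U * P) := by
    rw [hU, toda_eq]
    exact coprime_sq.add_mul_left_right _
  exact coprime_toda.of_mul_right_left

theorem derivation_bilin_two (h : D (D P) * Q - 2 * (D P * D Q) + P * D (D Q) = 0) :
    D (D (D P)) * Q - D (D P) * D Q - D P * D (D Q) + P * D (D (D Q)) = 0 := by
  have h' := congrArg D h
  simp only [map_add, map_sub, map_zero, D.leibniz, derivation_ofNat, smul_eq_mul] at h'
  linear_combination h'

namespace IsHirotaPair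

theorem symm (h : IsHirotaPair D x ν P Q) : IsHirotaPair D x (-ν) Q P where
  bilin_two := by linear_combination h.bilin_two
  bilin_three := by rw [map_neg]; linear_combination -h.bilin_three

theorem aeval {P Q : R[X]} (h : IsHirotaPair derivative' X ν P Q) (hx : D x = 1) :
    IsHirotaPair D x ν (aeval x P) (aeval x Q) := by
  have map_D (F : R[X]) : D (Polynomial.aeval x F) = Polynomial.aeval x (derivative' F) := by
    rw [D.map_aeval, hx, smul_eq_mul, mul_one, derivative'_apply]
  constructor
  · simpa [map_D, map_ofNat] using congrArg (Polynomial.aeval x) h.bilin_two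
  · simpa [map_D, map_ofNat] using congrArg (Polynomial.aeval x) h.bilin_three

theorem dvd_todaRHS (h : IsHirotaPair D x ν P Q) (hP : IsCoprime P (D P)) :
    P ∣ todaRHS D x Q := by
  refine hP.dvd_of_dvd_mul_left
    ⟨Q * (-2 * D (D (D Q)) + x * D Q - algebraMap R A ν * Q) + 2 * D Q * D (D Q), ?_⟩
  rw [todaRHS]
  linear_combination Q * h.bilin_three + Q * derivation_bilin_two h.bilin_two
    - 2 * D Q * h.bilin_two

section Next

variable (h : IsHirotaPair D x ν P Q) (hx : D x = 1) (hP : P ∈ A⁰) (hU : U * P = todaRHS D x Q)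

include h hx hP hU

theorem wronskian_eq :
    D U * P - U * D P = (2 * algebraMap R A ν + 1) * Q ^ 2 := by
  have hU' := congrArg D hU
  rw [derivation_todaRHS hx, D.leibniz, smul_eq_mul, smul_eq_mul] at hU'
  rw [todaRHS] at hU
  refine (mul_cancel_right_mem_nonZeroDivisors hP).1 ?_
  linear_combination P * hU' - 2 * D P * hU - 2 * Q * h.bilin_three
    - 2 * Q * derivation_bilin_two h.bilin_two + 4 * D Q * h.bilin_two

theorem derivation_wronskian_eq :
    D (D U) * P - U * D (D P) = 2 * (2 * algebraMap R A ν + 1) * Q * D Q := by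
  have W' := congrArg D (h.wronskian_eq hx hP hU)
  simp only [map_add, map_sub, pow_two, D.leibniz, D.map_algebraMap, D.map_one_eq_zero,
    derivation_ofNat, smul_eq_mul] at W'
  linear_combination W'

theorem bilin_two_next : D (D Q) * U - 2 * (D Q * D U) + Q * D (D U) = 0 := by
  refine (mul_cancel_right_mem_nonZeroDivisors hP).1 ?_
  linear_combination U * h.bilin_two - 2 * D Q * h.wronskian_eq hx hP hU
    + Q * h.derivation_wronskian_eq hx hP hU

theorem bilin_three_next :
    D (D (D U)) * Q - 3 * (D (D U) * D Q) + 3 * (D U * D (D Q)) - U * D (D (D Q))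
      - x * (D U * Q - U * D Q) + algebraMap R A (ν + 1) * (U * Q) = 0 := by
  have W := h.wronskian_eq hx hP hU
  have W' := h.derivation_wronskian_eq hx hP hU
  have W'' := congrArg D W'
  simp only [map_add, map_sub, D.leibniz, D.map_algebraMap, D.map_one_eq_zero,
    derivation_ofNat, smul_eq_mul] at W''
  have wronskian_D : D U * D (D P) - D (D U) * D P
      = -(2 * algebraMap R A ν + 1) * Q * D (D Q) := by
    refine (mul_cancel_right_mem_nonZeroDivisors hP).1 ?_
    linear_combination D (D P) * W - D P * W' + (2 * algebraMap R A ν + 1) * Q * h.bilin_two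
  have bilin_two_next' := derivation_bilin_two (h.bilin_two_next hx hP hU)
  rw [map_add, map_one]
  refine (mul_cancel_right_mem_nonZeroDivisors hP).1 ?_
  rw [todaRHS] at hU
  linear_combination 2 * Q * W'' + 2 * Q * wronskian_D - 4 * D Q * W' + 2 * D (D Q) * W
    - x * Q * W - U * h.bilin_three + U * derivation_bilin_two h.bilin_two
    - P * bilin_two_next' + (2 * algebraMap R A ν + 1) * Q * hU

theorem next : IsHirotaPair D x (ν + 1) Q U :=
  ⟨h.bilin_two_next hx hP hU, h.bilin_three_next hx hP hU⟩

theorem isCoprime_derivation_next (hν : IsUnit (2 * ν + 1)) (hQU : IsCoprime Q U) :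
    IsCoprime U (D U) := by
  have hν' : IsUnit (2 * algebraMap R A ν + 1) := by simpa [map_ofNat] using hν.map (algebraMap R A)
  have coprime_wronskian : IsCoprime U (D U * P - U * D P) := by
    rw [h.wronskian_eq hx hP hU, isCoprime_mul_unit_left_right hν']
    exact hQU.symm.pow_right
  rw [sub_eq_add_neg, ← mul_neg] at coprime_wronskian
  exact coprime_wronskian.of_add_mul_left_right.of_mul_right_left

end Next

theorem isPainleveTwoRegularPart {p q f g : A} (h : IsHirotaPair D x ν (t * p) q) (ht : D t = 1)
    (hp : D p = p * f) (hq : D q = q * g) (hpq : p * q ∈ A⁰) :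
    IsPainleveTwoRegularPart D t x ν (f - g) := by
  obtain ⟨h2, h3⟩ := h
  simp only [D.leibniz, map_add, map_zero, ht, hp, hq, smul_eq_mul, D.map_one_eq_zero] at h2 h3
  have riccati_two : 2 * (f - g) + t * ((f - g) ^ 2 + D f + D g) = 0 := by
    refine (mul_cancel_right_mem_nonZeroDivisors hpq).1 ?_
    linear_combination h2
  have riccati_three : -t * ((f - g) ^ 3 + 3 * (f - g) * (D f + D g) + (D (D f) - D (D g)))
      - 3 * (f - g) ^ 2 - 3 * (D f + D g) + x * (1 + t * (f - g)) + algebraMap R A ν * t = 0 := by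
    refine (mul_cancel_right_mem_nonZeroDivisors hpq).1 ?_
    linear_combination h3
  rw [IsPainleveTwoRegularPart, map_sub, map_sub]
  linear_combination -t * riccati_three - 3 * (t * (f - g) + 1) * riccati_two

end IsHirotaPair

end Derivation

section TaylorCoefficients

section CommRing

variable {R : Type*} [CommRing R] {ω ν : R}

theorem prod_X_add_C_ne_zero [IsDomain R] (s : Finset R) :
    ∏ a ∈ s, (PowerSeries.X + PowerSeries.C (ω - a)) ≠ 0 := by
  refine Finset.prod_ne_zero_iff.2 fun a _ h => ?_
  simpa using congrArg (PowerSeries.coeff 1) h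

theorem aeval_prod_X_sub_C (s : Finset R) :
    aeval (PowerSeries.X + PowerSeries.C ω : R⟦X⟧) (∏ a ∈ s, (X - C a))
      = ∏ a ∈ s, (PowerSeries.X + PowerSeries.C (ω - a)) := by
  simp only [map_prod, map_sub, aeval_X, aeval_C, PowerSeries.algebraMap_eq, add_sub_assoc]

/-- The powers of `X` are nested so that `PowerSeries.coeff_succ_X_mul` reads off coefficients. -/
theorem IsPainleveTwoRegularPart.X_mul_derivative_derivative {G : R⟦X⟧}
    (h : IsPainleveTwoRegularPart (d⁄dX R) PowerSeries.X (PowerSeries.X + PowerSeries.C ω) ν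
      (PowerSeries.X * G)) :
    PowerSeries.X * d⁄dX R (d⁄dX R (PowerSeries.X * G))
      = PowerSeries.C 6 * G + PowerSeries.C ω + PowerSeries.X * (1 + PowerSeries.C ν
        + PowerSeries.X * (PowerSeries.C ω * G + PowerSeries.C 6 * (G * G)
          + PowerSeries.X * (G + PowerSeries.X * (PowerSeries.C 2 * G ^ 3)))) := by
  apply PowerSeries.X_mul_cancel
  rw [IsPainleveTwoRegularPart, PowerSeries.algebraMap_eq] at h
  simp only [map_ofNat]
  linear_combination h

end CommRing

variable {K : Type*} [Field K] {ω ν : K}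

theorem coeff_inv_X_add_C {c : K} (hc : c ≠ 0) (n : ℕ) :
    PowerSeries.coeff n (PowerSeries.X + PowerSeries.C c)⁻¹ = (-1) ^ n * (1 / c ^ (n + 1)) := by
  have inv_eq : (PowerSeries.X + PowerSeries.C c)⁻¹
      = -PowerSeries.invUnitsSub (Units.mk0 (-c) (neg_ne_zero.2 hc)) := by
    rw [eq_comm, PowerSeries.eq_inv_iff_mul_eq_one (by simpa using hc)]
    rw [← PowerSeries.invUnitsSub_mul_sub (Units.mk0 (-c) (neg_ne_zero.2 hc)), Units.val_mk0,
      map_neg]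
    ring
  rw [inv_eq, map_neg, PowerSeries.coeff_invUnitsSub, divp_eq_div, Units.val_pow_eq_pow_val,
    Units.val_mk0, neg_pow, pow_succ (-1 : K)]
  rcases neg_one_pow_eq_or K n with h | h <;> simp [h]

theorem coeff_sum_inv_X_add_C {s : Finset K} (hs : ω ∉ s) (n : ℕ) :
    PowerSeries.coeff n (∑ a ∈ s, (PowerSeries.X + PowerSeries.C (ω - a))⁻¹)
      = (-1) ^ n * ∑ a ∈ s, 1 / (ω - a) ^ (n + 1) := by
  rw [map_sum, Finset.mul_sum]
  refine Finset.sum_congr rfl fun a ha => coeff_inv_X_add_C (sub_ne_zero.2 ?_) n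
  exact fun h => hs (h ▸ ha)

theorem derivative_prod_X_add_C {s : Finset K} (hs : ω ∉ s) :
    d⁄dX K (∏ a ∈ s, (PowerSeries.X + PowerSeries.C (ω - a)))
      = (∏ a ∈ s, (PowerSeries.X + PowerSeries.C (ω - a)))
        * ∑ a ∈ s, (PowerSeries.X + PowerSeries.C (ω - a))⁻¹ := by
  refine derivation_prod_eq_prod_mul_sum _ fun a ha => ?_
  have hne : ω - a ≠ 0 := sub_ne_zero.2 fun h => hs (h ▸ ha)
  rw [PowerSeries.mul_inv_cancel _ (by simpa using hne), map_add, PowerSeries.derivative_X,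
    PowerSeries.derivative_C, add_zero]

section CharZero

variable [CharZero K] {F : K⟦X⟧}

theorem constantCoeff_of_isPainleveTwoRegularPart {x : K⟦X⟧}
    (hF : IsPainleveTwoRegularPart (d⁄dX K) PowerSeries.X x ν F) :
    PowerSeries.constantCoeff F = 0 := by
  simpa [map_ofNat] using congrArg PowerSeries.constantCoeff hF

/-- Order 3 is missing because it is the resonance of Painlevé II: there the equation reads
`6 * c = 6 * c`, with `c` the coefficient. -/
theorem coeff_of_isPainleveTwoRegularPart
    (hF : IsPainleveTwoRegularPart (d⁄dX K) PowerSeries.X (PowerSeries.X + PowerSeries.C ω) ν F) :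
    PowerSeries.coeff 1 F = -ω / 6 ∧ PowerSeries.coeff 2 F = -(ν + 1) / 4 ∧
      PowerSeries.coeff 4 F = ω * ((ν + 1) / 24 - 1 / 36) := by
  obtain ⟨G, rfl⟩ := PowerSeries.X_dvd_iff.2 (constantCoeff_of_isPainleveTwoRegularPart hF)
  have painleve_G := hF.X_mul_derivative_derivative
  have order_zero : 0 = 6 * PowerSeries.constantCoeff G + ω := by
    simpa using congrArg (PowerSeries.coeff 0) painleve_G
  have order_one : 2 * PowerSeries.coeff 1 G = 6 * PowerSeries.coeff 1 G + (1 + ν) := by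
    have h := congrArg (PowerSeries.coeff 1) painleve_G
    simp only [map_add, PowerSeries.coeff_succ_X_mul, PowerSeries.coeff_derivative,
      PowerSeries.coeff_C_mul, PowerSeries.coeff_C, PowerSeries.coeff_one,
      PowerSeries.coeff_zero_eq_constantCoeff, map_mul, PowerSeries.constantCoeff_X,
      PowerSeries.constantCoeff_C, one_ne_zero, if_false, if_true, Nat.cast_zero, zero_mul] at h
    linear_combination h
  have order_three : PowerSeries.coeff 3 G * 3 * 4 = 6 * PowerSeries.coeff 3 G
      + (ω * PowerSeries.coeff 1 G + 6 * PowerSeries.coeff 1 (G * G)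
        + PowerSeries.constantCoeff G) := by
    have h := congrArg (PowerSeries.coeff 3) painleve_G
    simp only [map_add, PowerSeries.coeff_succ_X_mul, PowerSeries.coeff_derivative,
      PowerSeries.coeff_C_mul, PowerSeries.coeff_C, PowerSeries.coeff_one,
      PowerSeries.coeff_zero_eq_constantCoeff, map_mul, PowerSeries.constantCoeff_X,
      OfNat.ofNat_ne_zero, if_false, zero_mul, add_zero] at h
    linear_combination h
  have coeff_zero_eq : PowerSeries.constantCoeff G = -ω / 6 := by
    linear_combination -order_zero / 6
  have coeff_one_eq : PowerSeries.coeff 1 G = -(ν + 1) / 4 := by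
    linear_combination -order_one / 4
  rw [PowerSeries.coeff_one_mul, coeff_zero_eq, coeff_one_eq] at order_three
  simp only [PowerSeries.coeff_succ_X_mul, PowerSeries.coeff_zero_eq_constantCoeff_apply]
  exact ⟨coeff_zero_eq, coeff_one_eq, by linear_combination order_three / 6⟩

theorem IsHirotaPair.sum_inv_sub_pow [DecidableEq K] {s t : Finset K}
    (h : IsHirotaPair derivative' X ν (∏ a ∈ s, (X - C a)) (∏ b ∈ t, (X - C b)))
    (hs : ω ∈ s) (ht : ω ∉ t) :
    ∑ a ∈ s.erase ω, 1 / (ω - a) - ∑ b ∈ t, 1 / (ω - b) = 0 ∧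
    ∑ a ∈ s.erase ω, 1 / (ω - a) ^ 2 - ∑ b ∈ t, 1 / (ω - b) ^ 2 = ω / 6 ∧
    ∑ a ∈ s.erase ω, 1 / (ω - a) ^ 3 - ∑ b ∈ t, 1 / (ω - b) ^ 3 = -(ν + 1) / 4 ∧
    ∑ a ∈ s.erase ω, 1 / (ω - a) ^ 5 - ∑ b ∈ t, 1 / (ω - b) ^ 5
      = ω * ((ν + 1) / 24 - 1 / 36) := by
  have expansion := h.aeval (D := d⁄dX K) (x := PowerSeries.X + PowerSeries.C ω) (by simp)
  rw [aeval_prod_X_sub_C, aeval_prod_X_sub_C, ← Finset.mul_prod_erase s _ hs, sub_self, map_zero,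
    add_zero] at expansion
  have hs' : ω ∉ s.erase ω := Finset.notMem_erase ω s
  have painleve := expansion.isPainleveTwoRegularPart PowerSeries.derivative_X
    (derivative_prod_X_add_C hs') (derivative_prod_X_add_C ht)
    (mem_nonZeroDivisors_of_ne_zero (mul_ne_zero (prod_X_add_C_ne_zero _) (prod_X_add_C_ne_zero t)))
  have c0 := constantCoeff_of_isPainleveTwoRegularPart painleve
  obtain ⟨c1, c2, c4⟩ := coeff_of_isPainleveTwoRegularPart painleve
  rw [← PowerSeries.coeff_zero_eq_constantCoeff_apply] at c0
  rw [map_sub, coeff_sum_inv_X_add_C hs', coeff_sum_inv_X_add_C ht] at c0 c1 c2 c4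
  simp only [zero_add, pow_one] at c0
  exact ⟨by linear_combination c0, by linear_combination -c1, by linear_combination c2,
    by linear_combination c4⟩

end CharZero

end TaylorCoefficients

section TodaDegree

variable {R : Type*} [CommRing R] [Nontrivial R] {Q : R[X]}

theorem degree_todaRHS_tail_lt (hQ : Q.Monic) :
    (4 * (Q * derivative (derivative Q) - derivative Q ^ 2)).degree < (X * Q ^ 2).degree := by
  have hm : (X * Q ^ 2).Monic := monic_X.mul (hQ.pow 2)
  rw [degree_eq_natDegree hm.ne_zero, monic_X.natDegree_mul (hQ.pow 2), hQ.natDegree_pow,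
    natDegree_X]
  have natDegree_deriv := natDegree_derivative_le Q
  have natDegree_deriv_deriv := natDegree_derivative_le (derivative Q)
  rw [add_comm]
  refine lt_of_le_of_lt degree_le_natDegree (Nat.cast_lt.2 (Nat.lt_succ_of_le ?_))
  refine natDegree_mul_le.trans ?_
  rw [natDegree_ofNat, zero_add]
  refine (natDegree_sub_le _ _).trans
    (max_le (natDegree_mul_le.trans ?_) (natDegree_pow_le.trans ?_)) <;> omega

theorem monic_todaRHS (hQ : Q.Monic) : (todaRHS derivative' X Q).Monic :=
  (monic_X.mul (hQ.pow 2)).sub_of_left (degree_todaRHS_tail_lt hQ)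

theorem natDegree_todaRHS (hQ : Q.Monic) :
    (todaRHS derivative' X Q).natDegree = 2 * Q.natDegree + 1 := by
  refine (natDegree_eq_of_degree_eq
    (degree_sub_eq_left_of_degree_lt (degree_todaRHS_tail_lt hQ))).trans ?_
  rw [monic_X.natDegree_mul (hQ.pow 2), hQ.natDegree_pow, natDegree_X, add_comm]

end TodaDegree

theorem yablonskiiVorobev_add_two_mul_of_isHirotaPair {n : ℕ} {ν : ℂ}
    (h : IsHirotaPair derivative' X ν (yablonskiiVorobev n) (yablonskiiVorobev (n + 1)))
    (hn : (yablonskiiVorobev n).Separable) :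
    yablonskiiVorobev (n + 2) * yablonskiiVorobev n
      = todaRHS derivative' X (yablonskiiVorobev (n + 1)) := by
  rw [mul_comm, yablonskiiVorobev]
  exact EuclideanDomain.mul_div_cancel' hn.ne_zero (h.dvd_todaRHS hn)

theorem isHirotaPair_and_separable_yablonskiiVorobev (n : ℕ) :
    IsHirotaPair derivative' X ((n + 1 : ℕ) : ℂ) (yablonskiiVorobev n) (yablonskiiVorobev (n + 1)) ∧
      (yablonskiiVorobev n).Separable ∧ (yablonskiiVorobev (n + 1)).Separable := by
  induction n with
  | zero =>
    refine ⟨?_, separable_one, separable_X⟩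
    constructor <;> simp [yablonskiiVorobev]
  | succ n ih =>
    obtain ⟨h, hP, hQ⟩ := ih
    have hU := yablonskiiVorobev_add_two_mul_of_isHirotaPair h hP
    have hP' := mem_nonZeroDivisors_of_ne_zero hP.ne_zero
    have hν : IsUnit (2 * ((n + 1 : ℕ) : ℂ) + 1) := IsUnit.mk0 _ (by norm_cast)
    refine ⟨?_, hQ, h.isCoprime_derivation_next derivative_X hP' hU hν
      (isCoprime_of_mul_eq_todaRHS (D := derivative') (IsUnit.mk0 (2 : ℂ) two_ne_zero) hQ hU)⟩
    rw [Nat.cast_succ (n + 1)]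
    exact h.next derivative_X hP' hU

theorem isHirotaPair_yablonskiiVorobev (n : ℕ) :
    IsHirotaPair derivative' X ((n + 1 : ℕ) : ℂ)
      (yablonskiiVorobev n) (yablonskiiVorobev (n + 1)) :=
  (isHirotaPair_and_separable_yablonskiiVorobev n).1

theorem separable_yablonskiiVorobev (n : ℕ) : (yablonskiiVorobev n).Separable :=
  (isHirotaPair_and_separable_yablonskiiVorobev n).2.1

theorem yablonskiiVorobev_add_two_mul (n : ℕ) :
    yablonskiiVorobev (n + 2) * yablonskiiVorobev n
      = todaRHS derivative' X (yablonskiiVorobev (n + 1)) :=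
  yablonskiiVorobev_add_two_mul_of_isHirotaPair (isHirotaPair_yablonskiiVorobev n)
    (separable_yablonskiiVorobev n)

theorem isCoprime_yablonskiiVorobev_succ (n : ℕ) :
    IsCoprime (yablonskiiVorobev n) (yablonskiiVorobev (n + 1)) := by
  cases n with
  | zero => exact isCoprime_one_left
  | succ n =>
    exact isCoprime_of_mul_eq_todaRHS (D := derivative') (IsUnit.mk0 (2 : ℂ) two_ne_zero)
      (separable_yablonskiiVorobev (n + 1)) (yablonskiiVorobev_add_two_mul n)

theorem monic_yablonskiiVorobev (n : ℕ) : (yablonskiiVorobev n).Monic := by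
  induction n using Nat.twoStepInduction with
  | zero => exact monic_one
  | one => exact monic_X
  | more n hP hQ =>
    exact hP.of_mul_monic_right (yablonskiiVorobev_add_two_mul n ▸ monic_todaRHS hQ)

theorem two_mul_natDegree_yablonskiiVorobev (n : ℕ) :
    2 * (yablonskiiVorobev n).natDegree = n * (n + 1) := by
  induction n using Nat.twoStepInduction with
  | zero => simp [yablonskiiVorobev]
  | one => simp [yablonskiiVorobev]
  | more n hP hQ =>
    have h := natDegree_todaRHS (monic_yablonskiiVorobev (n + 1))
    rw [← yablonskiiVorobev_add_two_mul,
      (monic_yablonskiiVorobev (n + 2)).natDegree_mul (monic_yablonskiiVorobev n)] at h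
    linarith

theorem natDegree_yablonskiiVorobev (n : ℕ) :
    (yablonskiiVorobev n).natDegree = n * (n + 1) / 2 := by
  rw [← two_mul_natDegree_yablonskiiVorobev, Nat.mul_div_cancel_left _ two_pos]

theorem card_yvRoots (n : ℕ) : (yvRoots n).card = n * (n + 1) / 2 := by
  rw [yvRoots, Multiset.toFinset_card_of_nodup (nodup_roots (separable_yablonskiiVorobev n)),
    ← (IsAlgClosed.splits _).natDegree_eq_card_roots, natDegree_yablonskiiVorobev]

theorem prod_X_sub_C_yvRoots (n : ℕ) : ∏ a ∈ yvRoots n, (X - C a) = yablonskiiVorobev n := by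
  rw [(IsAlgClosed.splits _).eq_prod_roots_of_monic (monic_yablonskiiVorobev n), Finset.prod,
    yvRoots, Multiset.toFinset_val, (nodup_roots (separable_yablonskiiVorobev n)).dedup]

theorem disjoint_yvRoots_succ (n : ℕ) : Disjoint (yvRoots n) (yvRoots (n + 1)) := by
  obtain ⟨u, v, huv⟩ := isCoprime_yablonskiiVorobev_succ n
  refine Finset.disjoint_left.2 fun a ha hb => ?_
  have root_left := isRoot_of_mem_roots (Multiset.mem_toFinset.1 ha)
  have root_right := isRoot_of_mem_roots (Multiset.mem_toFinset.1 hb)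
  simpa [root_left.eq_zero, root_right.eq_zero] using congrArg (eval a) huv

theorem mainTheorem3 (n : ℕ) (hn : 1 ≤ n) :
    -- the recurrence holds exactly, so that the sequence really consists of polynomials
    yablonskiiVorobev (n + 1) * yablonskiiVorobev (n - 1)
      = X * yablonskiiVorobev n ^ 2
        - 4 * (yablonskiiVorobev n * derivative (derivative (yablonskiiVorobev n))
          - derivative (yablonskiiVorobev n) ^ 2) ∧
    -- degrees, simplicity of the roots, no common roots
    (yablonskiiVorobev (n - 1)).natDegree = n * (n - 1) / 2 ∧
    (yvRoots (n - 1)).card = n * (n - 1) / 2 ∧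
    (yablonskiiVorobev n).natDegree = n * (n + 1) / 2 ∧
    (yvRoots n).card = n * (n + 1) / 2 ∧
    Disjoint (yvRoots (n - 1)) (yvRoots n) ∧
    -- relations at the roots of the polynomial of index `n - 1`
    (∀ ω ∈ yvRoots (n - 1),
      ∑ a ∈ (yvRoots (n - 1)).erase ω, 1 / (ω - a)
          - ∑ b ∈ yvRoots n, 1 / (ω - b) = 0 ∧
      ∑ a ∈ (yvRoots (n - 1)).erase ω, 1 / (ω - a) ^ 2
          - ∑ b ∈ yvRoots n, 1 / (ω - b) ^ 2 = ω / 6 ∧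
      ∑ a ∈ (yvRoots (n - 1)).erase ω, 1 / (ω - a) ^ 3
          - ∑ b ∈ yvRoots n, 1 / (ω - b) ^ 3 = -((n : ℂ) + 1) / 4 ∧
      ∑ a ∈ (yvRoots (n - 1)).erase ω, 1 / (ω - a) ^ 5
          - ∑ b ∈ yvRoots n, 1 / (ω - b) ^ 5 = ω * (((n : ℂ) + 1) / 24 - 1 / 36)) ∧
    -- relations at the roots of the polynomial of index `n`
    (∀ ω ∈ yvRoots n,
      ∑ a ∈ yvRoots (n - 1), 1 / (ω - a)
          - ∑ b ∈ (yvRoots n).erase ω, 1 / (ω - b) = 0 ∧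
      ∑ a ∈ yvRoots (n - 1), 1 / (ω - a) ^ 2
          - ∑ b ∈ (yvRoots n).erase ω, 1 / (ω - b) ^ 2 = -ω / 6 ∧
      ∑ a ∈ yvRoots (n - 1), 1 / (ω - a) ^ 3
          - ∑ b ∈ (yvRoots n).erase ω, 1 / (ω - b) ^ 3 = -((n : ℂ) - 1) / 4 ∧
      ∑ a ∈ yvRoots (n - 1), 1 / (ω - a) ^ 5
          - ∑ b ∈ (yvRoots n).erase ω, 1 / (ω - b) ^ 5 = ω * (((n : ℂ) - 1) / 24 + 1 / 36)) := by
  obtain ⟨n, rfl⟩ := Nat.exists_eq_add_of_le' hn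
  rw [Nat.add_sub_cancel]
  have hirota := isHirotaPair_yablonskiiVorobev n
  rw [← prod_X_sub_C_yvRoots, ← prod_X_sub_C_yvRoots] at hirota
  have hdisj := disjoint_yvRoots_succ n
  refine ⟨yablonskiiVorobev_add_two_mul n, ?_, ?_, natDegree_yablonskiiVorobev (n + 1),
    card_yvRoots (n + 1), hdisj, fun ω hω => ?_, fun ω hω => ?_⟩
  · rw [natDegree_yablonskiiVorobev, mul_comm]
  · rw [card_yvRoots, mul_comm]
  · exact hirota.sum_inv_sub_pow hω (Finset.disjoint_left.1 hdisj hω)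
  · obtain ⟨B₁, B₂, B₃, B₅⟩ := hirota.symm.sum_inv_sub_pow hω (Finset.disjoint_right.1 hdisj hω)
    exact ⟨by linear_combination -B₁, by linear_combination -B₂, by linear_combination -B₃,
      by linear_combination -B₅⟩
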